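/- **Theorem 3.4.** Setting. Let $D\ge 1$, let $P$ be a random orthogonal $D\times D$ matrix (distributed according to the normalised Haar measure of the orthogonal group $O(D)$), let $o,q\in\mathbb{R}^D$ be an object and a query, let $dis=\|o-q\|$ be their Euclidean distance, and let $r$ be a threshold. The distance comparison operation is to decide whether $dis\le r$ and, if so, to return $dis$; the object is positive if $dis\le r$ and negative if $dis>r$. With parameter $\varepsilon_0\ge 0$, the algorithm ADSampling works on $y=Po-Pq$. For $d=1,2,\dots,D$ it samples the coordinate $y_d$ and computes $dis'=\sqrt{D/d}\,\|(y_1,\dots,y_d)\|$. If $d<D$ and $dis'>(1+\varepsilon_0/\sqrt d)\,r$, it stops and answers $0$ (meaning $dis>r$). If $d<D$ and $dis'\le(1+\varepsilon_0/\sqrt d)\,r$, it continues with $d+1$. If $d=D$, it stops and answers $1$ and returns $dis'$ if $dis'\le r$, and answers $0$ otherwise. The run fails if its result is not the correct result of the distance comparison operation. Let $\hat D$ be the number of coordinates sampled when the algorithm stops. Claim. There are absolute constants $c_0,C>0$ such that for every $D\ge 1$ and every $0<\delta\le 1$, with the choice $$\varepsilon_0=\sqrt{\tfrac1{c_0}\log\tfrac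 D\delta},\qquad\text{i.e. } \exp(-c_0\varepsilon_0^2+\log D)=\delta ,$$ the following two statements hold. 1. For every positive object (all $o,q\in\mathbb{R}^D$ and $r$ with $dis\le r$), the failure probability of ADSampling is at most $\delta$. 2. For every negative object (all $o,q\in\mathbb{R}^D$ and $r$ with $0<r<dis$), with distance gap $\alpha=(dis-r)/r$, the expectation of $\hat D$ exists and $$\mathbb{E}[\hat D]\le C\,\max\Big\{1,\ \min\Big(D,\ \frac1{\alpha^2}\log\frac D\delta\Big)\Big\}.$$ In particular $\mathbb{E}[\hat D]=O\big(\min(D,\alpha^{-2}\log(D/\delta))\big)$, with an absolute constant, whenever $\alpha^2\le\log(D/\delta)$. -/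

import Mathlib

open MeasureTheory

noncomputable section

namespace ADSampling

/-! ### The random orthogonal matrix -/

theorem isCompact_orthogonalGroup (D : ℕ) :
    IsCompact (Matrix.orthogonalGroup (Fin D) ℝ : Set (Matrix (Fin D) (Fin D) ℝ)) := by
  have hbox : IsCompact (Set.univ.pi fun _ : Fin D =>
      Set.univ.pi fun _ : Fin D => Set.Icc (-1 : ℝ) 1) :=
    isCompact_univ_pi fun _ => isCompact_univ_pi fun _ => isCompact_Icc
  have hclosed : IsClosed (Matrix.orthogonalGroup (Fin D) ℝ : Set (Matrix (Fin D) (Fin D) ℝ)) :=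
    isClosed_unitary
  refine hbox.of_isClosed_subset hclosed ?_
  intro U hU i _ j _
  have h := entry_norm_bound_of_unitary (𝕜 := ℝ) (U := U) hU i j
  exact abs_le.mp h

instance (D : ℕ) : CompactSpace (Matrix.orthogonalGroup (Fin D) ℝ) :=
  isCompact_iff_compactSpace.mp (isCompact_orthogonalGroup D)

instance (D : ℕ) : MeasurableSpace (Matrix.orthogonalGroup (Fin D) ℝ) := borel _

instance (D : ℕ) : BorelSpace (Matrix.orthogonalGroup (Fin D) ℝ) := ⟨rfl⟩

/-- The law of a random orthogonal `D × D` matrix: the Haar measure of the orthogonal group,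
normalised to total mass `1`. -/
def orthogonalHaar (D : ℕ) : Measure (Matrix.orthogonalGroup (Fin D) ℝ) :=
  Measure.haarMeasure ⊤

instance (D : ℕ) : IsProbabilityMeasure (orthogonalHaar D) :=
  ⟨by simpa [orthogonalHaar] using
    Measure.haarMeasure_self (K₀ := (⊤ : TopologicalSpace.PositiveCompacts
      (Matrix.orthogonalGroup (Fin D) ℝ)))⟩

/-- The vector `x` transformed by the orthogonal matrix `P`, i.e. the product `P x`. -/
def transform {D : ℕ} (P : Matrix.orthogonalGroup (Fin D) ℝ) (x : EuclideanSpace ℝ (Fin D)) :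
    EuclideanSpace ℝ (Fin D) :=
  WithLp.toLp 2 ((P : Matrix (Fin D) (Fin D) ℝ).mulVec x.ofLp)

/-! ### The algorithm -/

/-- The approximate distance `√(D / d) * ‖(y₁, …, y_d)‖` computed from the first `d` coordinates
of `y = o' - q'`. -/
def approxDist {D : ℕ} (o' q' : EuclideanSpace ℝ (Fin D)) (d : ℕ) : ℝ :=
  √((D : ℝ) / d) * √(∑ i : Fin D with i.val < d, (o' i - q' i) ^ 2)

/-- The test with parameter `ε₀` based on the first `d` coordinates rejects the hypothesis that
the distance is at most `r`. -/
def Rejects {D : ℕ} (ε₀ r : ℝ) (o' q' : EuclideanSpace ℝ (Fin D)) (d : ℕ) : Prop :=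
  approxDist o' q' d > (1 + ε₀ / √(d : ℝ)) * r

/-- What a run returns, together with the number of dimensions that it has sampled.
The answer `none` is the answer `0` ("the distance exceeds the threshold"); the answer `some t` is
the answer `1` ("the distance is at most the threshold") together with the distance `t`. -/
structure Result where
  answer : Option ℝ
  sampledDims : ℕ

open Classical in
/-- The main loop, entered with `d` dimensions already sampled; each iteration samples one further
dimension and performs one test. -/
def loop {D : ℕ} (ε₀ r : ℝ) (o' q' : EuclideanSpace ℝ (Fin D)) (d : ℕ) : Result :=
  if d < D then
    if Rejects ε₀ r o' q' (d + 1) ∧ d + 1 < D then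
      { answer := none, sampledDims := d + 1 }
    else if d + 1 < D then
      loop ε₀ r o' q' (d + 1)
    else
      { answer := if approxDist o' q' (d + 1) ≤ r then some (approxDist o' q' (d + 1)) else none
        sampledDims := d + 1 }
  else
    { answer := none, sampledDims := d }
termination_by D - d

/-- The algorithm on a transformed data vector `o'`, a transformed query vector `q'` and the
distance threshold `r`. -/
def run {D : ℕ} (ε₀ r : ℝ) (o' q' : EuclideanSpace ℝ (Fin D)) : Result :=
  loop ε₀ r o' q' 0

open Classical in
/-- The correct result of the distance comparison operation: decide whether the distance of the
object `o` from the query `q` is at most `r`, and return the distance if so. -/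
def exactAnswer {D : ℕ} (r : ℝ) (o q : EuclideanSpace ℝ (Fin D)) : Option ℝ :=
  if dist o q ≤ r then some (dist o q) else none

/-- The event (a set of orthogonal matrices `P`) that the algorithm, run on the vectors transformed
by `P`, does not give the correct result. -/
def failure {D : ℕ} (ε₀ r : ℝ) (o q : EuclideanSpace ℝ (Fin D)) :
    Set (Matrix.orthogonalGroup (Fin D) ℝ) :=
  {P | (run ε₀ r (transform P o) (transform P q)).answer ≠ exactAnswer r o q}

/-- The random number of dimensions that the algorithm samples. -/
def numSampled {D : ℕ} (ε₀ r : ℝ) (o q : EuclideanSpace ℝ (Fin D))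
    (P : Matrix.orthogonalGroup (Fin D) ℝ) : ℝ :=
  ((run ε₀ r (transform P o) (transform P q)).sampledDims : ℝ)

end ADSampling

end

noncomputable section
namespace ADSampling

section

open Matrix

/-! ### Invariance properties of the random orthogonal matrix -/

/-! Everything rests on one tail bound, `measure_weightedEvent_le`: for positive weights and `x ≠
0`, the event ∑ wᵢ (Px)ᵢ² ≤ ‖x‖² has probability at most ∏ wᵢ^(-1/2). Invariance of Haar measure
makes this probability independent of `x`, so `x` may be replaced by a Gaussian vector. Each `P`
preserves the Gaussian law, and Chernoff's bound for independent coordinates finishes.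

Weights with two values turn this into concentration (`measure_headSq_deviation_le`): for d < D,
√(D/d) times the norm of the first d coordinates of Px exceeds (1+s)‖x‖, or is at most (1-s)‖x‖ with
s < 1, each with probability at most exp(-ds²/2).

For a positive object, s = ε₀/√d gives exp(-ε₀²/2) for every d < D; a union bound suffices because
the last comparison is exact. For a negative object, the expected count is at most 1 plus the sum
over k < D of the probabilities that test k does not reject. Terms with k < 4ε₀²/α² are bounded by
1; for later k the threshold lies a fixed factor below the distance, so the terms are dominated by a
geometric series. -/

instance (D : ℕ) : (orthogonalHaar D).IsHaarMeasure := by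
  unfold orthogonalHaar
  infer_instance

/-- A right translate of a left Haar measure is left Haar; with both masses equal to 1, uniqueness
applies. -/
theorem orthogonalHaar_map_mul_right {D : ℕ} (Q : Matrix.orthogonalGroup (Fin D) ℝ) :
    (orthogonalHaar D).map (· * Q) = orthogonalHaar D := by
  have : IsProbabilityMeasure ((orthogonalHaar D).map (· * Q)) :=
    Measure.isProbabilityMeasure_map (measurable_mul_const Q).aemeasurable
  exact Measure.isHaarMeasure_eq_of_isProbabilityMeasure _ _

theorem measurable_coe_apply {D : ℕ} (i j : Fin D) :
    Measurable fun P : Matrix.orthogonalGroup (Fin D) ℝ => (P : Matrix (Fin D) (Fin D) ℝ) i j := by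
  have h : Continuous fun P : Matrix.orthogonalGroup (Fin D) ℝ =>
      (P : Matrix (Fin D) (Fin D) ℝ) i j :=
    (continuous_subtype_val (p := fun M => M ∈ Matrix.orthogonalGroup (Fin D) ℝ)).matrix_elem i j
  exact h.measurable

theorem measurable_mulVec {D : ℕ} :
    Measurable fun z : Matrix.orthogonalGroup (Fin D) ℝ × (Fin D → ℝ) =>
      (z.1 : Matrix (Fin D) (Fin D) ℝ) *ᵥ z.2 := by
  refine measurable_pi_lambda _ fun i => ?_
  simp only [Matrix.mulVec, dotProduct]
  exact Finset.measurable_sum _ fun j _ =>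
    ((measurable_coe_apply i j).comp measurable_fst).mul
      ((measurable_pi_apply j).comp measurable_snd)

theorem dotProduct_mulVec_self {D : ℕ} (P : Matrix.orthogonalGroup (Fin D) ℝ) (x : Fin D → ℝ) :
    ((P : Matrix (Fin D) (Fin D) ℝ) *ᵥ x) ⬝ᵥ ((P : Matrix (Fin D) (Fin D) ℝ) *ᵥ x) = x ⬝ᵥ x := by
  have h := (Matrix.mem_orthogonalGroup_iff' (Fin D) ℝ).1 P.2
  rw [dotProduct_mulVec, ← mulVec_transpose, mulVec_mulVec, h, one_mulVec]

/-- The orthogonal group acts transitively on spheres. -/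
theorem exists_orthogonal_mulVec_eq {D : ℕ} {x y : Fin D → ℝ} (h : x ⬝ᵥ x = y ⬝ᵥ y) :
    ∃ Q : Matrix.orthogonalGroup (Fin D) ℝ, (Q : Matrix (Fin D) (Fin D) ℝ) *ᵥ x = y := by
  by_cases hxy : x = y
  · exact ⟨1, by simp [hxy]⟩
  set v := x - y with hv
  have hv0 : v ⬝ᵥ v ≠ 0 := by
    rw [Ne, dotProduct_self_eq_zero]
    exact sub_ne_zero.2 hxy
  have hvx : 2 * (v ⬝ᵥ x) = v ⬝ᵥ v := by
    simp only [hv, sub_dotProduct, dotProduct_sub, dotProduct_comm y x]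
    linarith
  -- The Householder reflection in the hyperplane orthogonal to `x - y`.
  refine ⟨⟨1 - (2 / (v ⬝ᵥ v)) • vecMulVec v v, ?_⟩, ?_⟩
  · rw [Matrix.mem_orthogonalGroup_iff]
    have ht : (1 - (2 / (v ⬝ᵥ v)) • vecMulVec v v)ᵀ = 1 - (2 / (v ⬝ᵥ v)) • vecMulVec v v := by
      simp [transpose_vecMulVec]
    rw [ht, mul_sub, sub_mul, sub_mul, smul_mul_smul_comm, vecMulVec_mul_vecMulVec,
      vecMulVec_smul, smul_smul]
    simp only [mul_one, one_mul]
    have : 2 / (v ⬝ᵥ v) * (2 / (v ⬝ᵥ v)) * (v ⬝ᵥ v) = 2 / (v ⬝ᵥ v) + 2 / (v ⬝ᵥ v) := by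
      field_simp
      norm_num
    rw [this, add_smul]
    abel
  · simp only [sub_mulVec, one_mulVec, smul_mulVec, vecMulVec_mulVec, op_smul_eq_smul, smul_smul]
    have : 2 / (v ⬝ᵥ v) * (v ⬝ᵥ x) = 1 := by
      rw [div_mul_eq_mul_div, hvx, div_self hv0]
    rw [this, one_smul, hv]
    abel

theorem measurePreserving_mulVec {D : ℕ} (P : Matrix.orthogonalGroup (Fin D) ℝ) :
    MeasurePreserving (fun x : Fin D → ℝ => (P : Matrix (Fin D) (Fin D) ℝ) *ᵥ x) := by
  have hdet : (P : Matrix (Fin D) (Fin D) ℝ).det * (P : Matrix (Fin D) (Fin D) ℝ).det = 1 := by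
    have h := congrArg Matrix.det ((Matrix.mem_orthogonalGroup_iff (Fin D) ℝ).1 P.2)
    rwa [det_mul, det_transpose, det_one] at h
  have hne : (P : Matrix (Fin D) (Fin D) ℝ).det ≠ 0 := fun h => by simp [h] at hdet
  have habs : |((P : Matrix (Fin D) (Fin D) ℝ).det)⁻¹| = 1 := by
    rw [abs_inv, inv_eq_one]
    rcases mul_self_eq_one_iff.1 hdet with h | h <;> simp [h]
  refine ⟨measurable_mulVec.comp measurable_prodMk_left, ?_⟩
  have h := Real.map_matrix_volume_pi_eq_smul_volume_pi hne
  rw [habs, ENNReal.ofReal_one, one_smul] at h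
  exact h

/-! ### A tail bound for weighted sums of squares -/

/-- The event that the weighted sum of squares of the coordinates of `P x` is at most `‖x‖ ^ 2`. -/
def weightedEvent {D : ℕ} (w x : Fin D → ℝ) : Set (Matrix.orthogonalGroup (Fin D) ℝ) :=
  {P | ∑ i, w i * ((P : Matrix (Fin D) (Fin D) ℝ) *ᵥ x) i ^ 2 ≤ x ⬝ᵥ x}

theorem measurable_weightedSum {D : ℕ} (w : Fin D → ℝ) :
    Measurable fun z : Matrix.orthogonalGroup (Fin D) ℝ × (Fin D → ℝ) =>
      ∑ i, w i * ((z.1 : Matrix (Fin D) (Fin D) ℝ) *ᵥ z.2) i ^ 2 :=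
  Finset.measurable_sum _ fun i _ =>
    (((measurable_pi_apply i).comp measurable_mulVec).pow_const 2).const_mul _

theorem measurable_dotProduct_self {D : ℕ} : Measurable fun x : Fin D → ℝ => x ⬝ᵥ x := by
  simp only [dotProduct]
  fun_prop

theorem measurableSet_weightedEvent {D : ℕ} (w x : Fin D → ℝ) :
    MeasurableSet (weightedEvent w x) := by
  have h : Measurable fun P : Matrix.orthogonalGroup (Fin D) ℝ =>
      ∑ i, w i * ((P : Matrix (Fin D) (Fin D) ℝ) *ᵥ x) i ^ 2 :=
    Finset.measurable_sum _ fun i _ => (((measurable_pi_apply i).comp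
      (measurable_mulVec.comp (measurable_id.prodMk measurable_const))).pow_const 2).const_mul _
  exact measurableSet_le h measurable_const

theorem measure_weightedEvent_mulVec {D : ℕ} (w x : Fin D → ℝ)
    (Q : Matrix.orthogonalGroup (Fin D) ℝ) :
    orthogonalHaar D (weightedEvent w ((Q : Matrix (Fin D) (Fin D) ℝ) *ᵥ x)) =
      orthogonalHaar D (weightedEvent w x) := by
  conv_rhs => rw [← orthogonalHaar_map_mul_right Q]
  rw [Measure.map_apply (measurable_mul_const Q) (measurableSet_weightedEvent w x)]
  congr 1
  ext P
  simp [weightedEvent, dotProduct_mulVec_self, mulVec_mulVec]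

theorem weightedEvent_smul {D : ℕ} (w x : Fin D → ℝ) {c : ℝ} (hc : c ≠ 0) :
    weightedEvent w (c • x) = weightedEvent w x := by
  ext P
  have h : ∑ i, w i * ((P : Matrix (Fin D) (Fin D) ℝ) *ᵥ (c • x)) i ^ 2 =
      c ^ 2 * ∑ i, w i * ((P : Matrix (Fin D) (Fin D) ℝ) *ᵥ x) i ^ 2 := by
    rw [Finset.mul_sum]
    refine Finset.sum_congr rfl fun i _ => ?_
    rw [mulVec_smul, Pi.smul_apply, smul_eq_mul]
    ring
  have h' : (c • x) ⬝ᵥ (c • x) = c ^ 2 * (x ⬝ᵥ x) := by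
    rw [smul_dotProduct, dotProduct_smul, smul_eq_mul, smul_eq_mul]
    ring
  simp only [weightedEvent, Set.mem_ofPred_eq, h, h']
  exact mul_le_mul_iff_right₀ (by positivity)

/-- The event is homogeneous in the vector, so `x` can be rescaled to the length of `y` and then
rotated onto it. -/
theorem measure_weightedEvent_eq {D : ℕ} (w : Fin D → ℝ) {x y : Fin D → ℝ} (hx : x ≠ 0)
    (hy : y ≠ 0) :
    orthogonalHaar D (weightedEvent w x) = orthogonalHaar D (weightedEvent w y) := by
  have hpos : ∀ {z : Fin D → ℝ}, z ≠ 0 → 0 < z ⬝ᵥ z := fun {z} hz =>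
    lt_of_le_of_ne (Finset.sum_nonneg fun i _ => mul_self_nonneg _)
      (Ne.symm (mt dotProduct_self_eq_zero.1 hz))
  set c := √((y ⬝ᵥ y) / (x ⬝ᵥ x)) with hc
  have hq : 0 < (y ⬝ᵥ y) / (x ⬝ᵥ x) := div_pos (hpos hy) (hpos hx)
  have hc0 : c ≠ 0 := (Real.sqrt_pos.2 hq).ne'
  have heq : (c • x) ⬝ᵥ (c • x) = y ⬝ᵥ y := by
    rw [smul_dotProduct, dotProduct_smul, smul_eq_mul, smul_eq_mul, ← mul_assoc, hc,
      Real.mul_self_sqrt hq.le, div_mul_cancel₀ _ (hpos hx).ne']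
  obtain ⟨Q, hQ⟩ := exists_orthogonal_mulVec_eq heq
  rw [← weightedEvent_smul w x hc0, ← measure_weightedEvent_mulVec w _ Q, hQ]

theorem lintegral_exp_neg_weightedSum {D : ℕ} {w : Fin D → ℝ} (hw : ∀ i, 0 < w i) :
    ∫⁻ x : Fin D → ℝ, ENNReal.ofReal (Real.exp (-(∑ i, w i * x i ^ 2) / 2)) =
      ENNReal.ofReal (∏ i, √(Real.pi / (w i / 2))) := by
  have h : ∀ x : Fin D → ℝ, Real.exp (-(∑ i, w i * x i ^ 2) / 2) =
      ∏ i, Real.exp (-(w i / 2) * x i ^ 2) := fun x => by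
    rw [← Real.exp_sum, neg_div, Finset.sum_div, ← Finset.sum_neg_distrib]
    congr 1
    exact Finset.sum_congr rfl fun i _ => by ring
  simp only [h]
  have hint : Integrable fun x : Fin D → ℝ => ∏ i, Real.exp (-(w i / 2) * x i ^ 2) :=
    Integrable.fintype_prod (f := fun i (t : ℝ) => Real.exp (-(w i / 2) * t ^ 2))
      fun i => integrable_exp_neg_mul_sq (half_pos (hw i))
  rw [← ofReal_integral_eq_lintegral_ofReal hint (ae_of_all _ fun x => by positivity),
    integral_fintype_prod_volume_eq_prod fun i (t : ℝ) => Real.exp (-(w i / 2) * t ^ 2)]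
  simp only [integral_gaussian]

/-- The Gaussian weight `g` is integrated over pairs (P, y) in the event, in both orders.
Integrating over `P` first gives the wanted probability times the Gaussian mass; integrating over
`y` first gives a Gaussian integral free of `P`. -/
theorem measure_weightedEvent_le {D : ℕ} {w x : Fin D → ℝ} (hw : ∀ i, 0 < w i) (hx : x ≠ 0) :
    orthogonalHaar D (weightedEvent w x) ≤ ENNReal.ofReal (∏ i, √(1 / w i)) := by
  set μ := orthogonalHaar D
  set g : (Fin D → ℝ) → ENNReal := fun y => ENNReal.ofReal (Real.exp (-(y ⬝ᵥ y) / 2)) with hg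
  have hgm : Measurable g := (measurable_dotProduct_self.neg.div_const 2).exp.ennreal_ofReal
  have hgint : ∫⁻ y, g y = ENNReal.ofReal (∏ _i : Fin D, √(Real.pi / (1 / 2))) := by
    rw [← lintegral_exp_neg_weightedSum fun _ => one_pos]
    simp only [hg, one_mul, dotProduct, pow_two]
  -- A nonzero `x` forces D ≥ 1, so the origin is a null set.
  have hne : ∀ᵐ y : Fin D → ℝ, y ≠ 0 := by
    have : Nonempty (Fin D) := by
      by_contra h
      rw [not_nonempty_iff] at h
      exact hx (Subsingleton.elim _ _)
    exact Measure.ae_ne _ 0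
  set S : Set (Matrix.orthogonalGroup (Fin D) ℝ × (Fin D → ℝ)) :=
    {z | ∑ i, w i * ((z.1 : Matrix (Fin D) (Fin D) ℝ) *ᵥ z.2) i ^ 2 ≤ z.2 ⬝ᵥ z.2} with hS
  have hSm : MeasurableSet S :=
    measurableSet_le (measurable_weightedSum w) (measurable_dotProduct_self.comp measurable_snd)
  set T : Set (Fin D → ℝ) := {y | ∑ i, w i * y i ^ 2 ≤ y ⬝ᵥ y} with hT
  have hTm : MeasurableSet T := measurableSet_le (by fun_prop) measurable_dotProduct_self
  set F : Matrix.orthogonalGroup (Fin D) ℝ → (Fin D → ℝ) → ENNReal :=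
    fun P y => S.indicator (fun z => g z.2) (P, y) with hF
  have hFm : Measurable (Function.uncurry F) := (hgm.comp measurable_snd).indicator hSm
  have h1 : ∫⁻ y, ∫⁻ P, F P y ∂μ = μ (weightedEvent w x) * ∫⁻ y, g y := by
    rw [← lintegral_const_mul _ hgm]
    refine lintegral_congr_ae (hne.mono fun y hy => ?_)
    have : ∀ P, F P y = (weightedEvent w y).indicator (fun _ => g y) P := fun P => rfl
    simp only [this]
    rw [lintegral_indicator_const (measurableSet_weightedEvent w y),
      measure_weightedEvent_eq w hx hy, mul_comm]
  -- Substituting Py for y preserves Lebesgue measure and `g`, and removes `P`.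
  have h2 : ∫⁻ P, (∫⁻ y, F P y) ∂μ = ∫⁻ y, T.indicator g y := by
    have : ∀ P, ∫⁻ y, F P y = ∫⁻ y, T.indicator g y := fun P => by
      rw [← (measurePreserving_mulVec P).lintegral_comp (hgm.indicator hTm)]
      refine lintegral_congr fun y => ?_
      simp only [hF, hS, hT, hg, Set.indicator, Set.mem_ofPred_eq, dotProduct_mulVec_self]
    simp only [this, lintegral_const, measure_univ, mul_one]
  -- Chernoff: on `T`, exp(-‖y‖²/2) ≤ exp(-∑ wᵢ yᵢ²/2).
  have h3 : ∫⁻ y, T.indicator g y ≤ ENNReal.ofReal (∏ i, √(Real.pi / (w i / 2))) := by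
    rw [← lintegral_exp_neg_weightedSum hw]
    refine lintegral_mono (Set.indicator_le' (fun y hy => ?_) (fun _ _ => zero_le))
    have hy' : ∑ i, w i * y i ^ 2 ≤ y ⬝ᵥ y := hy
    exact ENNReal.ofReal_le_ofReal (Real.exp_le_exp.2 (by linarith))
  have h4 : (∏ i, √(Real.pi / (w i / 2))) =
      (∏ i, √(1 / w i)) * ∏ _i : Fin D, √(Real.pi / (1 / 2)) := by
    rw [← Finset.prod_mul_distrib]
    refine Finset.prod_congr rfl fun i _ => ?_
    rw [← Real.sqrt_mul (one_div_pos.2 (hw i)).le]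
    congr 1
    have := (hw i).ne'
    field_simp
  rw [h4, ENNReal.ofReal_mul (Finset.prod_nonneg fun _ _ => Real.sqrt_nonneg _), ← h2,
    lintegral_lintegral_swap hFm.aemeasurable, h1, hgint] at h3
  refine (ENNReal.mul_le_mul_iff_left ?_ ENNReal.ofReal_ne_top).1 h3
  rw [Ne, ENNReal.ofReal_eq_zero, not_le]
  exact Finset.prod_pos fun i _ => Real.sqrt_pos.2 (by positivity)

end

section

open Matrix

/-! ### Concentration of the squared length of the first coordinates -/

/-- The squared length of the first `d` coordinates of `P x`. -/
def headSq {D : ℕ} (d : ℕ) (x : Fin D → ℝ) (P : Matrix.orthogonalGroup (Fin D) ℝ) : ℝ :=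
  ∑ i : Fin D with i.val < d, ((P : Matrix (Fin D) (Fin D) ℝ) *ᵥ x) i ^ 2

theorem headSq_add_sum_compl {D : ℕ} (d : ℕ) (x : Fin D → ℝ)
    (P : Matrix.orthogonalGroup (Fin D) ℝ) :
    headSq d x P + ∑ i : Fin D with ¬ i.val < d, ((P : Matrix (Fin D) (Fin D) ℝ) *ᵥ x) i ^ 2 =
      x ⬝ᵥ x := by
  rw [headSq, Finset.sum_filter_add_sum_filter_not, ← dotProduct_mulVec_self P x]
  simp only [dotProduct, pow_two]

theorem headSq_le {D : ℕ} (d : ℕ) (x : Fin D → ℝ) (P : Matrix.orthogonalGroup (Fin D) ℝ) :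
    headSq d x P ≤ x ⬝ᵥ x := by
  rw [← headSq_add_sum_compl d x P]
  exact le_add_of_nonneg_right (Finset.sum_nonneg fun _ _ => sq_nonneg _)

theorem headSq_self {D : ℕ} (x : Fin D → ℝ) (P : Matrix.orthogonalGroup (Fin D) ℝ) :
    headSq D x P = x ⬝ᵥ x := by
  rw [← headSq_add_sum_compl D x P]
  simp

theorem measurable_headSq {D : ℕ} (d : ℕ) (x : Fin D → ℝ) : Measurable (headSq d x) :=
  Finset.measurable_sum _ fun i _ => ((measurable_pi_apply i).comp
    (measurable_mulVec.comp (measurable_id.prodMk measurable_const))).pow_const 2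

theorem card_filter_val_lt {D d : ℕ} (hd : d ≤ D) :
    (Finset.univ.filter fun i : Fin D => i.val < d).card = d := by
  rw [Fin.card_filter_val_lt, min_eq_right hd]

theorem card_filter_not_val_lt {D d : ℕ} (hd : d ≤ D) :
    (Finset.univ.filter fun i : Fin D => ¬ i.val < d).card = D - d := by
  have h := Finset.card_filter_add_card_filter_not (s := (Finset.univ : Finset (Fin D)))
    fun i : Fin D => i.val < d
  rw [card_filter_val_lt hd, Finset.card_univ, Fintype.card_fin] at h
  omega

/-- Apply 1 + t ≤ exp t to each factor; the exponents ds and d(1 - (1+s)²)/2 add up to -ds²/2. -/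
theorem pow_mul_sqrt_pow_le_exp {D d : ℕ} {s p : ℝ} (hdD : d < D) (hs : -1 < s)
    (hp : p = (d : ℝ) / D) :
    (1 + s) ^ d * √((1 - (1 + s) ^ 2 * p) / (1 - p)) ^ (D - d) ≤ Real.exp (-(d * s ^ 2 / 2)) := by
  have hD : (0 : ℝ) < D := by exact_mod_cast (Nat.zero_le d).trans_lt hdD
  have hdD' : (d : ℝ) < D := by exact_mod_cast hdD
  have hp1 : 0 < 1 - p := by
    rw [hp, sub_pos, div_lt_one hD]
    exact hdD'
  have h1 : (1 + s) ^ d ≤ Real.exp (d * s) := by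
    rw [Real.exp_nat_mul]
    have := Real.add_one_le_exp s
    exact pow_le_pow_left₀ (by linarith) (by linarith) d
  set e := (1 - (1 + s) ^ 2) * p / (1 - p) with he
  have h2 : √((1 - (1 + s) ^ 2 * p) / (1 - p)) ≤ Real.exp (e / 2) := by
    rw [Real.sqrt_le_iff]
    refine ⟨(Real.exp_pos _).le, ?_⟩
    rw [← Real.exp_nat_mul]
    have h3 : (1 - (1 + s) ^ 2 * p) / (1 - p) = e + 1 := by
      rw [he]
      field_simp
      ring
    rw [h3]
    convert Real.add_one_le_exp e using 2
    push_cast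
    ring
  have h4 : √((1 - (1 + s) ^ 2 * p) / (1 - p)) ^ (D - d) ≤
      Real.exp (d * (1 - (1 + s) ^ 2) / 2) := by
    refine (pow_le_pow_left₀ (Real.sqrt_nonneg _) h2 _).trans_eq ?_
    rw [← Real.exp_nat_mul, Nat.cast_sub hdD.le]
    congr 1
    rw [he, hp]
    have : (D : ℝ) - d ≠ 0 := by linarith
    field_simp
  calc _ ≤ Real.exp (d * s) * Real.exp (d * (1 - (1 + s) ^ 2) / 2) :=
        mul_le_mul h1 h4 (by positivity) (Real.exp_pos _).le
    _ = _ := by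
        rw [← Real.exp_add]
        congr 1
        ring

/-- The factor (1+s)² - 1 carries the sign of `s`, so one statement covers the upper tail (s > 0)
and the lower tail (s < 0). -/
theorem measure_headSq_deviation_le {D d : ℕ} {s : ℝ} {x : Fin D → ℝ} (hdD : d < D)
    (hs : -1 < s) (hsd : (1 + s) ^ 2 * ((d : ℝ) / D) < 1) (hx : x ≠ 0) :
    orthogonalHaar D {P | 0 ≤ ((1 + s) ^ 2 - 1) *
        (headSq d x P - (1 + s) ^ 2 * ((d : ℝ) / D) * (x ⬝ᵥ x))} ≤
      ENNReal.ofReal (Real.exp (-(d * s ^ 2 / 2))) := by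
  have hD : (0 : ℝ) < D := by exact_mod_cast (Nat.zero_le d).trans_lt hdD
  have hdD' : (d : ℝ) < D := by exact_mod_cast hdD
  set p := (d : ℝ) / D with hp
  set β := (1 + s) ^ 2 with hβ
  have hs1 : 0 < 1 + s := by linarith
  have hβ0 : 0 < β := by positivity
  have hp1 : 0 < 1 - p := by
    rw [hp, sub_pos, div_lt_one hD]
    exact hdD'
  have hb0 : 0 < 1 - β * p := sub_pos.2 hsd
  -- These weights make the weighted sum equal ‖x‖² exactly when `headSq` is βp‖x‖²; under that
  -- constraint they minimise ∏ wᵢ^(-1/2).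
  set w : Fin D → ℝ := fun i => if i.val < d then 1 / β else (1 - p) / (1 - β * p) with hw
  have hw0 : ∀ i, 0 < w i := fun i => by
    simp only [hw]
    split_ifs <;> positivity
  have hprod : ∏ i, √(1 / w i) ≤ Real.exp (-(d * s ^ 2 / 2)) := by
    have h1 : ∀ i, √(1 / w i) = if i.val < d then 1 + s else √((1 - β * p) / (1 - p)) := fun i => by
      simp only [hw]
      split_ifs
      · rw [one_div_one_div, hβ, Real.sqrt_sq hs1.le]
      · rw [one_div_div]
    simp only [h1, Finset.prod_ite, Finset.prod_const]
    rw [card_filter_val_lt hdD.le, card_filter_not_val_lt hdD.le]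
    exact pow_mul_sqrt_pow_le_exp hdD hs hp
  refine (measure_mono fun P hP => ?_).trans
    ((measure_weightedEvent_le hw0 hx).trans (ENNReal.ofReal_le_ofReal hprod))
  have hP' : 0 ≤ (β - 1) * (headSq d x P - β * p * (x ⬝ᵥ x)) := hP
  have hsum : ∑ i, w i * ((P : Matrix (Fin D) (Fin D) ℝ) *ᵥ x) i ^ 2 =
      1 / β * headSq d x P + (1 - p) / (1 - β * p) * (x ⬝ᵥ x - headSq d x P) := by
    rw [← Finset.sum_filter_add_sum_filter_not Finset.univ fun i : Fin D => i.val < d,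
      ← headSq_add_sum_compl d x P, add_sub_cancel_left, headSq, Finset.mul_sum, Finset.mul_sum]
    congr 1
    · refine Finset.sum_congr rfl fun i hi => ?_
      simp only [hw, if_pos (Finset.mem_filter.1 hi).2]
    · refine Finset.sum_congr rfl fun i hi => ?_
      simp only [hw, if_neg (Finset.mem_filter.1 hi).2]
  have hkey : x ⬝ᵥ x - (1 / β * headSq d x P +
      (1 - p) / (1 - β * p) * (x ⬝ᵥ x - headSq d x P)) =
      (β - 1) * (headSq d x P - β * p * (x ⬝ᵥ x)) / (β * (1 - β * p)) := by
    field_simp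
    ring
  have : 0 ≤ (β - 1) * (headSq d x P - β * p * (x ⬝ᵥ x)) / (β * (1 - β * p)) := by positivity
  change ∑ i, w i * ((P : Matrix (Fin D) (Fin D) ℝ) *ᵥ x) i ^ 2 ≤ x ⬝ᵥ x
  rw [hsum]
  linarith

theorem measure_headSq_gt_le {D d : ℕ} {s : ℝ} {x : Fin D → ℝ} (hdD : d < D) (hs : 0 ≤ s)
    (hx : x ≠ 0) :
    orthogonalHaar D {P | (1 + s) ^ 2 * ((d : ℝ) / D) * (x ⬝ᵥ x) < headSq d x P} ≤
      ENNReal.ofReal (Real.exp (-(d * s ^ 2 / 2))) := by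
  rcases lt_or_ge ((1 + s) ^ 2 * ((d : ℝ) / D)) 1 with h | h
  · refine (measure_mono fun P hP => ?_).trans
      (measure_headSq_deviation_le hdD (by linarith) h hx)
    have hsq : 0 ≤ (1 + s) ^ 2 - 1 := by nlinarith
    exact mul_nonneg hsq (sub_nonneg.2 (le_of_lt hP))
  -- Here the threshold is at least ‖x‖², which `headSq` never exceeds.
  · have hN : 0 ≤ x ⬝ᵥ x := Finset.sum_nonneg fun i _ => mul_self_nonneg _
    have : {P | (1 + s) ^ 2 * ((d : ℝ) / D) * (x ⬝ᵥ x) < headSq d x P} = ∅ := by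
      ext P
      simp only [Set.mem_ofPred_eq, Set.mem_empty_iff_false, iff_false, not_lt]
      exact (headSq_le d x P).trans (le_mul_of_one_le_left hN h)
    rw [this, measure_empty]
    exact zero_le

theorem measure_headSq_le_le {D d : ℕ} {s : ℝ} {x : Fin D → ℝ} (hdD : d < D) (hs : 0 ≤ s)
    (hs1 : s < 1) (hx : x ≠ 0) :
    orthogonalHaar D {P | headSq d x P ≤ (1 - s) ^ 2 * ((d : ℝ) / D) * (x ⬝ᵥ x)} ≤
      ENNReal.ofReal (Real.exp (-(d * s ^ 2 / 2))) := by
  have hD : (0 : ℝ) < D := by exact_mod_cast (Nat.zero_le d).trans_lt hdD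
  have hp : (d : ℝ) / D < 1 := by
    rw [div_lt_one hD]
    exact_mod_cast hdD
  have hp0 : 0 ≤ (d : ℝ) / D := by positivity
  have hsq : (1 - s) ^ 2 ≤ 1 := by nlinarith
  have h := measure_headSq_deviation_le (s := -s) hdD (by linarith)
    (by rw [← sub_eq_add_neg]; nlinarith) hx
  rw [neg_sq] at h
  refine (measure_mono fun P hP => ?_).trans h
  have hP' : headSq d x P ≤ (1 - s) ^ 2 * ((d : ℝ) / D) * (x ⬝ᵥ x) := hP
  change 0 ≤ ((1 + -s) ^ 2 - 1) * (headSq d x P - (1 + -s) ^ 2 * ((d : ℝ) / D) * (x ⬝ᵥ x))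
  rw [← sub_eq_add_neg]
  exact mul_nonneg_of_nonpos_of_nonpos (by linarith) (by linarith)

end
/-! ### Analysis of the main loop -/

/-- Induction on `n`, the number of iterations left after the coming one; at n = 0 that iteration is
the final comparison. -/
theorem loop_answer_of_not_rejects {D : ℕ} {ε₀ r : ℝ} {o' q' : EuclideanSpace ℝ (Fin D)}
    (n : ℕ) : ∀ d, d + n + 1 = D → (∀ k ∈ Finset.Ico 1 D, ¬ Rejects ε₀ r o' q' k) →
      (loop ε₀ r o' q' d).answer =
        if approxDist o' q' D ≤ r then some (approxDist o' q' D) else none := by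
  induction n with
  | zero =>
    intro d hd _
    rw [loop, if_pos (by omega), if_neg (by rintro ⟨-, h⟩; omega), if_neg (by omega)]
    have : d + 1 = D := by omega
    rw [this]
  | succ n ih =>
    intro d hd h
    rw [loop, if_pos (by omega),
      if_neg (fun h' => h (d + 1) (Finset.mem_Ico.2 ⟨by omega, h'.2⟩) h'.1), if_pos (by omega)]
    exact ih (d + 1) (by omega) h

theorem sampledDims_loop_le_dim {D : ℕ} {ε₀ r : ℝ} {o' q' : EuclideanSpace ℝ (Fin D)}
    (n : ℕ) : ∀ d, d + n + 1 = D → (loop ε₀ r o' q' d).sampledDims ≤ D := by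
  induction n with
  | zero =>
    intro d hd
    rw [loop, if_pos (by omega), if_neg (by rintro ⟨-, h⟩; omega), if_neg (by omega)]
    exact hd.le
  | succ n ih =>
    intro d hd
    rw [loop, if_pos (by omega)]
    have hlt : d + 1 < D := by omega
    split_ifs
    · exact hlt.le
    · exact ih (d + 1) (by omega)

-- Coordinate k + 1 is sampled only if test k did not reject. Forgetting the earlier tests leaves a
-- sum of single-test indicators.
open Classical in
theorem sampledDims_loop_le_sum {D : ℕ} {ε₀ r : ℝ} {o' q' : EuclideanSpace ℝ (Fin D)}
    (n : ℕ) : ∀ d, d + n + 1 = D → (loop ε₀ r o' q' d).sampledDims ≤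
      d + 1 + ∑ k ∈ Finset.Ico (d + 1) D, if Rejects ε₀ r o' q' k then 0 else 1 := by
  induction n with
  | zero =>
    intro d hd
    rw [loop, if_pos (by omega), if_neg (by rintro ⟨-, h⟩; omega), if_neg (by omega)]
    exact Nat.le_add_right _ _
  | succ n ih =>
    intro d hd
    rw [loop, if_pos (by omega)]
    have hlt : d + 1 < D := by omega
    by_cases h : Rejects ε₀ r o' q' (d + 1)
    · rw [if_pos ⟨h, hlt⟩]
      exact Nat.le_add_right _ _
    · rw [if_neg fun h' => h h'.1, if_pos hlt, Finset.sum_eq_sum_Ico_succ_bot hlt, if_neg h]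
      have := ih (d + 1) (by omega)
      omega

theorem measurable_sampledDims_loop {D : ℕ} {ε₀ r : ℝ} {Ω : Type*} [MeasurableSpace Ω]
    {f g : Ω → EuclideanSpace ℝ (Fin D)}
    (hR : ∀ k, MeasurableSet {ω | Rejects ε₀ r (f ω) (g ω) k}) (n : ℕ) :
    ∀ d, d + n + 1 = D → Measurable fun ω => (loop ε₀ r (f ω) (g ω) d).sampledDims := by
  classical
  induction n with
  | zero =>
    intro d hd
    have : ∀ ω, (loop ε₀ r (f ω) (g ω) d).sampledDims = d + 1 := fun ω => by
      rw [loop, if_pos (by omega), if_neg (by rintro ⟨-, h⟩; omega), if_neg (by omega)]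
    simp only [this]
    exact measurable_const
  | succ n ih =>
    intro d hd
    have : ∀ ω, (loop ε₀ r (f ω) (g ω) d).sampledDims =
        if Rejects ε₀ r (f ω) (g ω) (d + 1) then d + 1
          else (loop ε₀ r (f ω) (g ω) (d + 1)).sampledDims := fun ω => by
      have hlt : d + 1 < D := by omega
      rw [loop, if_pos (by omega)]
      by_cases h : Rejects ε₀ r (f ω) (g ω) (d + 1)
      · rw [if_pos ⟨h, hlt⟩, if_pos h]
      · rw [if_neg fun h' => h h'.1, if_pos hlt, if_neg h]
    simp only [this]
    exact Measurable.ite (hR (d + 1)) measurable_const (ih (d + 1) (by omega))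

section

open Matrix

/-! ### The test on transformed vectors -/

theorem approxDist_transform {D : ℕ} (o q : EuclideanSpace ℝ (Fin D))
    (P : Matrix.orthogonalGroup (Fin D) ℝ) (d : ℕ) :
    approxDist (transform P o) (transform P q) d =
      √((D : ℝ) / d * headSq d (o.ofLp - q.ofLp) P) := by
  rw [approxDist, Real.sqrt_mul (by positivity), headSq, mulVec_sub]
  rfl

theorem dist_sq_eq_dotProduct {D : ℕ} (o q : EuclideanSpace ℝ (Fin D)) :
    dist o q ^ 2 = (o.ofLp - q.ofLp) ⬝ᵥ (o.ofLp - q.ofLp) := by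
  rw [EuclideanSpace.dist_eq, Real.sq_sqrt (Finset.sum_nonneg fun _ _ => sq_nonneg _)]
  refine Finset.sum_congr rfl fun i _ => ?_
  rw [Real.dist_eq, sq_abs, pow_two]
  rfl

theorem approxDist_transform_self {D : ℕ} (hD : 1 ≤ D) (o q : EuclideanSpace ℝ (Fin D))
    (P : Matrix.orthogonalGroup (Fin D) ℝ) :
    approxDist (transform P o) (transform P q) D = dist o q := by
  have hD' : (D : ℝ) ≠ 0 := by exact_mod_cast (by omega : D ≠ 0)
  rw [approxDist_transform, div_self hD', one_mul, headSq_self, ← dist_sq_eq_dotProduct,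
    Real.sqrt_sq dist_nonneg]

theorem measurableSet_rejects {D : ℕ} (ε₀ r : ℝ) (o q : EuclideanSpace ℝ (Fin D)) (d : ℕ) :
    MeasurableSet {P : Matrix.orthogonalGroup (Fin D) ℝ |
      Rejects ε₀ r (transform P o) (transform P q) d} := by
  simp only [Rejects, approxDist_transform]
  exact measurableSet_lt measurable_const (((measurable_headSq d _).const_mul _).sqrt)

theorem ofLp_sub_ne_zero {D : ℕ} {o q : EuclideanSpace ℝ (Fin D)} (h : 0 < dist o q) :
    o.ofLp - q.ofLp ≠ 0 := by
  intro h0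
  have := dist_sq_eq_dotProduct o q
  rw [h0, dotProduct_zero] at this
  exact h.ne' (pow_eq_zero_iff two_ne_zero |>.1 this)

/-- The slack ε₀/√d is scaled so that the exponent ds²/2 is ε₀²/2 for every d. -/
theorem measure_rejects_le {D d : ℕ} {ε₀ r : ℝ} {o q : EuclideanSpace ℝ (Fin D)} (hd : 1 ≤ d)
    (hdD : d < D) (hε : 0 ≤ ε₀) (hr : dist o q ≤ r) :
    orthogonalHaar D {P | Rejects ε₀ r (transform P o) (transform P q) d} ≤
      ENNReal.ofReal (Real.exp (-(ε₀ ^ 2 / 2))) := by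
  have hd0 : (0 : ℝ) < d := by exact_mod_cast hd
  have hD0 : (0 : ℝ) < D := by exact_mod_cast (by omega : 0 < D)
  set s := ε₀ / √(d : ℝ) with hs
  have hs0 : 0 ≤ s := by positivity
  have hds : d * s ^ 2 / 2 = ε₀ ^ 2 / 2 := by
    rw [hs, div_pow, Real.sq_sqrt hd0.le, mul_div_cancel₀ _ hd0.ne']
  have himp : ∀ P, Rejects ε₀ r (transform P o) (transform P q) d →
      (1 + s) ^ 2 * ((d : ℝ) / D) * ((o.ofLp - q.ofLp) ⬝ᵥ (o.ofLp - q.ofLp)) <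
        headSq d (o.ofLp - q.ofLp) P := fun P hP => by
    rw [Rejects, approxDist_transform] at hP
    have h1 : (1 + s) * dist o q < √((D : ℝ) / d * headSq d (o.ofLp - q.ofLp) P) :=
      (mul_le_mul_of_nonneg_left hr (by positivity)).trans_lt hP
    rw [Real.lt_sqrt (by positivity), mul_pow, dist_sq_eq_dotProduct, div_mul_eq_mul_div,
      lt_div_iff₀ hd0] at h1
    rw [mul_div_assoc', div_mul_eq_mul_div, div_lt_iff₀ hD0]
    linarith
  -- Concentration needs a nonzero vector; at distance 0 no test can reject.
  rcases (dist_nonneg : 0 ≤ dist o q).eq_or_lt with h0 | h0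
  · have : {P | Rejects ε₀ r (transform P o) (transform P q) d} = ∅ := by
      ext P
      simp only [Set.mem_ofPred_eq, Set.mem_empty_iff_false, iff_false]
      intro hP
      have h1 := himp P hP
      have h2 := headSq_le d (o.ofLp - q.ofLp) P
      rw [← dist_sq_eq_dotProduct, ← h0] at h1 h2
      linarith
    rw [this, measure_empty]
    exact zero_le
  · rw [← hds]
    exact (measure_mono himp).trans (measure_headSq_gt_le hdD hs0 (ofLp_sub_ne_zero h0))

theorem measure_not_rejects_le {D d : ℕ} {ε₀ r s : ℝ} {o q : EuclideanSpace ℝ (Fin D)}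
    (hd : 1 ≤ d) (hdD : d < D) (hs : 0 ≤ s) (hs1 : s < 1) (h0 : 0 < dist o q)
    (hr : (1 + ε₀ / √(d : ℝ)) * r ≤ (1 - s) * dist o q) :
    orthogonalHaar D {P | ¬ Rejects ε₀ r (transform P o) (transform P q) d} ≤
      ENNReal.ofReal (Real.exp (-(d * s ^ 2 / 2))) := by
  have hd0 : (0 : ℝ) < d := by exact_mod_cast hd
  have hD0 : (0 : ℝ) < D := by exact_mod_cast (by omega : 0 < D)
  refine (measure_mono fun P hP => ?_).trans
    (measure_headSq_le_le hdD hs hs1 (ofLp_sub_ne_zero h0))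
  have hP' : ¬ Rejects ε₀ r (transform P o) (transform P q) d := hP
  rw [Rejects, approxDist_transform, gt_iff_lt, not_lt] at hP'
  have h1 := (Real.sqrt_le_iff.1 (hP'.trans hr)).2
  rw [mul_pow, dist_sq_eq_dotProduct, div_mul_eq_mul_div, div_le_iff₀ hd0] at h1
  change headSq d (o.ofLp - q.ofLp) P ≤ _
  rw [mul_div_assoc', div_mul_eq_mul_div, le_div_iff₀ hD0]
  linarith

end

/-! ### Failure probability -/

theorem measure_failure_le {D : ℕ} {ε₀ r : ℝ} {o q : EuclideanSpace ℝ (Fin D)} (hD : 1 ≤ D)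
    (hε : 0 ≤ ε₀) (hr : dist o q ≤ r) :
    orthogonalHaar D (failure ε₀ r o q) ≤ ENNReal.ofReal (D * Real.exp (-(ε₀ ^ 2 / 2))) := by
  have hsub : failure ε₀ r o q ⊆
      ⋃ k ∈ Finset.Ico 1 D, {P | Rejects ε₀ r (transform P o) (transform P q) k} := fun P hP => by
    by_contra h
    simp only [Set.mem_iUnion, Set.mem_ofPred_eq, not_exists] at h
    refine hP ?_
    rw [run, loop_answer_of_not_rejects (D - 1) 0 (by omega) h, approxDist_transform_self hD]
    rfl
  calc _ ≤ ∑ k ∈ Finset.Ico 1 D,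
          orthogonalHaar D {P | Rejects ε₀ r (transform P o) (transform P q) k} :=
        (measure_mono hsub).trans (measure_biUnion_finset_le _ _)
    _ ≤ ∑ _k ∈ Finset.Ico 1 D, ENNReal.ofReal (Real.exp (-(ε₀ ^ 2 / 2))) :=
        Finset.sum_le_sum fun k hk => measure_rejects_le (Finset.mem_Ico.1 hk).1
          (Finset.mem_Ico.1 hk).2 hε hr
    _ ≤ _ := by
        rw [Finset.sum_const, Nat.card_Ico, nsmul_eq_mul, ENNReal.ofReal_mul (Nat.cast_nonneg D),
          ENNReal.ofReal_natCast]
        gcongr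
        omega

/-! ### The expected number of sampled dimensions -/

theorem measurable_numSampled {D : ℕ} (hD : 1 ≤ D) (ε₀ r : ℝ) (o q : EuclideanSpace ℝ (Fin D)) :
    Measurable (numSampled ε₀ r o q) :=
  measurable_from_nat.comp (measurable_sampledDims_loop
    (fun k => measurableSet_rejects ε₀ r o q k) (D - 1) 0 (by omega))

theorem numSampled_le {D : ℕ} (hD : 1 ≤ D) (ε₀ r : ℝ) (o q : EuclideanSpace ℝ (Fin D))
    (P : Matrix.orthogonalGroup (Fin D) ℝ) : numSampled ε₀ r o q P ≤ D := by
  rw [numSampled, run]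
  exact_mod_cast sampledDims_loop_le_dim (D - 1) 0 (by omega)

theorem integrable_numSampled {D : ℕ} (hD : 1 ≤ D) (ε₀ r : ℝ)
    (o q : EuclideanSpace ℝ (Fin D)) : Integrable (numSampled ε₀ r o q) (orthogonalHaar D) := by
  refine Integrable.of_bound (measurable_numSampled hD ε₀ r o q).aestronglyMeasurable (D : ℝ)
    (ae_of_all _ fun P => ?_)
  rw [Real.norm_of_nonneg (by exact Nat.cast_nonneg _)]
  exact numSampled_le hD ε₀ r o q P

theorem integral_numSampled_le_dim {D : ℕ} (hD : 1 ≤ D) (ε₀ r : ℝ)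
    (o q : EuclideanSpace ℝ (Fin D)) :
    ∫ P, numSampled ε₀ r o q P ∂(orthogonalHaar D) ≤ D := by
  refine (integral_mono (integrable_numSampled hD ε₀ r o q) (integrable_const (D : ℝ))
    fun P => numSampled_le hD ε₀ r o q P).trans_eq ?_
  simp

theorem integral_numSampled_le_sum {D : ℕ} (hD : 1 ≤ D) (ε₀ r : ℝ)
    (o q : EuclideanSpace ℝ (Fin D)) :
    ∫ P, numSampled ε₀ r o q P ∂(orthogonalHaar D) ≤ 1 + ∑ k ∈ Finset.Ico 1 D,
      (orthogonalHaar D).real {P | ¬ Rejects ε₀ r (transform P o) (transform P q) k} := by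
  classical
  set A : ℕ → Set (Matrix.orthogonalGroup (Fin D) ℝ) :=
    fun k => {P | ¬ Rejects ε₀ r (transform P o) (transform P q) k} with hA
  have hAm : ∀ k, MeasurableSet (A k) := fun k => (measurableSet_rejects ε₀ r o q k).compl
  have hpt : ∀ P, numSampled ε₀ r o q P ≤
      1 + ∑ k ∈ Finset.Ico 1 D, (A k).indicator (fun _ => (1 : ℝ)) P := fun P => by
    have h := sampledDims_loop_le_sum (ε₀ := ε₀) (r := r) (o' := transform P o)
      (q' := transform P q) (D - 1) 0 (by omega)
    have h' : numSampled ε₀ r o q P ≤ ((0 + 1 + ∑ k ∈ Finset.Ico (0 + 1) D,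
        if Rejects ε₀ r (transform P o) (transform P q) k then 0 else 1 : ℕ) : ℝ) := by
      rw [numSampled, run]
      exact_mod_cast h
    refine h'.trans_eq ?_
    push_cast
    congr 1
    refine Finset.sum_congr rfl fun k _ => ?_
    by_cases hk : Rejects ε₀ r (transform P o) (transform P q) k <;>
      simp [hA, Set.indicator, hk]
  have hi : ∀ k ∈ Finset.Ico 1 D,
      Integrable ((A k).indicator fun _ => (1 : ℝ)) (orthogonalHaar D) :=
    fun k _ => (integrable_const 1).indicator (hAm k)
  refine (integral_mono (integrable_numSampled hD ε₀ r o q)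
    ((integrable_const (1 : ℝ)).add (integrable_finsetSum _ hi)) hpt).trans_eq ?_
  simp only [Pi.add_apply]
  rw [integral_add (integrable_const (1 : ℝ)) (integrable_finsetSum _ hi),
    integral_finsetSum _ hi]
  simp only [integral_const, probReal_univ, integral_indicator_const _ (hAm _), smul_eq_mul,
    mul_one]
  rfl

/-! ### Two elementary sums and the resulting gap bound. -/

theorem sum_range_exp_neg_mul_le {η : ℝ} (hη : 0 < η) (n : ℕ) :
    ∑ k ∈ Finset.range n, Real.exp (-(k * η)) ≤ 1 + 1 / η := by
  have hq1 : Real.exp (-η) < 1 := Real.exp_lt_one_iff.2 (neg_lt_zero.2 hη)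
  have h : ∀ k : ℕ, Real.exp (-(k * η)) = Real.exp (-η) ^ k := fun k => by
    rw [← Real.exp_nat_mul, mul_neg]
  simp only [h]
  have hsum : ∑ k ∈ Finset.range n, Real.exp (-η) ^ k ≤ (1 - Real.exp (-η))⁻¹ := by
    rw [← tsum_geometric_of_lt_one (Real.exp_pos _).le hq1]
    exact (summable_geometric_of_lt_one (Real.exp_pos _).le hq1).sum_le_tsum _
      fun k _ => by positivity
  refine hsum.trans ?_
  rw [inv_le_iff_one_le_mul₀ (sub_pos.2 hq1)]
  have h1 : Real.exp (-η) * (1 + η) ≤ 1 := by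
    rw [Real.exp_neg, inv_mul_le_iff₀ (Real.exp_pos _), mul_one, add_comm]
    exact Real.add_one_le_exp η
  rw [one_add_div hη.ne', div_mul_eq_mul_div, le_div_iff₀ hη]
  nlinarith

theorem sum_Ico_indicator_lt_le {T : ℝ} (hT : 0 ≤ T) (D : ℕ) :
    ∑ k ∈ Finset.Ico 1 D, (if (k : ℝ) < T then (1 : ℝ) else 0) ≤ T := by
  rw [Finset.sum_boole]
  have hsub : (Finset.Ico 1 D).filter (fun k : ℕ => (k : ℝ) < T) ⊆ Finset.Ico 1 ⌈T⌉₊ :=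
    fun k hk => by
      rw [Finset.mem_filter, Finset.mem_Ico] at hk
      exact Finset.mem_Ico.2 ⟨hk.1.1, Nat.lt_ceil.2 hk.2⟩
  have hcard := Finset.card_le_card hsub
  rw [Nat.card_Ico] at hcard
  rcases hT.eq_or_lt with rfl | hT
  · simp
  · have h1 : 1 ≤ ⌈T⌉₊ := Nat.one_le_iff_ne_zero.2 (Nat.ceil_pos.2 hT).ne'
    have h2 := Nat.ceil_lt_add_one hT.le
    -- Counting from 1 rather than 0 saves the unit lost in the ceiling.
    have h3 : (((Finset.Ico 1 D).filter (fun k : ℕ => (k : ℝ) < T)).card : ℝ) + 1 ≤ ⌈T⌉₊ := by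
      exact_mod_cast (by omega :
        ((Finset.Ico 1 D).filter (fun k : ℕ => (k : ℝ) < T)).card + 1 ≤ ⌈T⌉₊)
    linarith

theorem integral_numSampled_le {D : ℕ} {ε₀ r α : ℝ} {o q : EuclideanSpace ℝ (Fin D)}
    (hD : 1 ≤ D) (hr : 0 < r) (hα : 0 < α) (hdist : dist o q = (1 + α) * r) :
    ∫ P, numSampled ε₀ r o q P ∂(orthogonalHaar D) ≤
      2 + 4 * ε₀ ^ 2 / α ^ 2 + 8 * (1 + α) ^ 2 / α ^ 2 := by
  -- Chosen so that (1-s)(1+α) = 1 + α/2: the threshold allows half of the gap.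
  set s := α / (2 * (1 + α)) with hs
  have hs0 : 0 < s := by positivity
  have hs1 : s < 1 := by
    rw [hs, div_lt_one (by positivity)]
    linarith
  -- From k ≥ T on, ε₀/√k ≤ α/2.
  set T := 4 * ε₀ ^ 2 / α ^ 2 with hT
  have hT0 : 0 ≤ T := by positivity
  have hdist0 : 0 < dist o q := by
    rw [hdist]
    positivity
  have hterm : ∀ k ∈ Finset.Ico 1 D,
      (orthogonalHaar D).real {P | ¬ Rejects ε₀ r (transform P o) (transform P q) k} ≤
        (if (k : ℝ) < T then (1 : ℝ) else 0) + Real.exp (-(k * (s ^ 2 / 2))) := fun k hk => by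
    rw [Finset.mem_Ico] at hk
    have hk0 : (0 : ℝ) < k := by exact_mod_cast hk.1
    split_ifs with hkT
    · exact measureReal_le_one.trans (le_add_of_nonneg_right (Real.exp_pos _).le)
    · rw [not_lt] at hkT
      have hε' : ε₀ / √(k : ℝ) ≤ α / 2 := by
        rw [div_le_iff₀ (Real.sqrt_pos.2 hk0)]
        refine le_of_sq_le_sq ?_ (by positivity)
        rw [mul_pow, Real.sq_sqrt hk0.le]
        rw [hT, div_le_iff₀ (by positivity)] at hkT
        linarith
      have hle : (1 + ε₀ / √(k : ℝ)) * r ≤ (1 - s) * dist o q := by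
        have : (1 - s) * ((1 + α) * r) = (1 + α / 2) * r := by
          rw [hs]
          field_simp
          ring
        rw [hdist, this]
        gcongr
      have h := measure_not_rejects_le hk.1 hk.2 hs0.le hs1 hdist0 hle
      rw [zero_add, ← mul_div_assoc]
      exact ENNReal.toReal_le_of_le_ofReal (Real.exp_pos _).le h
  have hexp : ∑ k ∈ Finset.Ico 1 D, Real.exp (-(k * (s ^ 2 / 2))) ≤ 1 + 1 / (s ^ 2 / 2) := by
    refine le_trans (Finset.sum_le_sum_of_subset_of_nonneg ?_ fun k _ _ => (Real.exp_pos _).le)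
      (sum_range_exp_neg_mul_le (by positivity) D)
    rw [Finset.range_eq_Ico]
    exact Finset.Ico_subset_Ico_left (Nat.zero_le 1)
  have hsum := Finset.sum_le_sum hterm
  rw [Finset.sum_add_distrib] at hsum
  have hη : 1 / (s ^ 2 / 2) = 8 * (1 + α) ^ 2 / α ^ 2 := by
    rw [hs]
    field_simp
    norm_num
  have h1 := integral_numSampled_le_sum hD ε₀ r o q
  have h2 := sum_Ico_indicator_lt_le hT0 D
  linarith

end ADSampling
end

/-! ### Choice of the absolute constants. -/

theorem theorem3p4 :
    ∃ c₀ C : ℝ, 0 < c₀ ∧ 0 < C ∧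
      ∀ (D : ℕ) (δ ε₀ : ℝ), 1 ≤ D → 0 < δ → δ ≤ 1 →
        ε₀ = √(Real.log ((D : ℝ) / δ) / c₀) →
        (∀ (o q : EuclideanSpace ℝ (Fin D)) (r : ℝ), dist o q ≤ r →
          ADSampling.orthogonalHaar D (ADSampling.failure ε₀ r o q) ≤ ENNReal.ofReal δ) ∧
        (∀ (o q : EuclideanSpace ℝ (Fin D)) (r α : ℝ), 0 < r → r < dist o q →
          α = (dist o q - r) / r →
          MeasureTheory.Integrable (ADSampling.numSampled ε₀ r o q)
              (ADSampling.orthogonalHaar D) ∧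
            ∫ P, ADSampling.numSampled ε₀ r o q P ∂(ADSampling.orthogonalHaar D) ≤
              C * max 1 (min (D : ℝ) (1 / α ^ 2 * Real.log ((D : ℝ) / δ)))) := by
  -- c₀ = 1/2 is the rate in exp(-ε₀²/2). With X = L/α², the gap bound becomes at most 2 + 8X + 16 +
  -- 32X = 18 + 40X, whence 58.
  refine ⟨1 / 2, 58, by norm_num, by norm_num, fun D δ ε₀ hD hδ hδ1 hε => ?_⟩
  have hD1 : (1 : ℝ) ≤ D := by exact_mod_cast hD
  have hq : 0 < (D : ℝ) / δ := by positivity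
  have hDle : (D : ℝ) ≤ D / δ := le_div_self (by linarith) hδ hδ1
  have hlog : 0 ≤ Real.log ((D : ℝ) / δ) := Real.log_nonneg (hD1.trans hDle)
  have hε0 : 0 ≤ ε₀ := hε ▸ Real.sqrt_nonneg _
  have hεsq : ε₀ ^ 2 = 2 * Real.log ((D : ℝ) / δ) := by
    rw [hε, Real.sq_sqrt (by positivity)]
    ring
  refine ⟨fun o q r hr => ?_, fun o q r α hr hrd hα => ?_⟩
  · refine (ADSampling.measure_failure_le hD hε0 hr).trans_eq ?_
    rw [hεsq, mul_div_cancel_left₀ _ two_ne_zero, Real.exp_neg, Real.exp_log hq, inv_div,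
      mul_div_cancel₀ _ (by positivity)]
  · refine ⟨ADSampling.integrable_numSampled hD ε₀ r o q, ?_⟩
    have hα0 : 0 < α := hα ▸ div_pos (sub_pos.2 hrd) hr
    have hdist : dist o q = (1 + α) * r := by
      rw [hα]
      field_simp
      ring
    have hdim := ADSampling.integral_numSampled_le_dim hD ε₀ r o q
    have hgap := ADSampling.integral_numSampled_le (ε₀ := ε₀) hD hr hα0 hdist
    set E := ∫ P, ADSampling.numSampled ε₀ r o q P ∂(ADSampling.orthogonalHaar D)
    set L := Real.log ((D : ℝ) / δ) with hL
    have hm1 := le_max_left 1 (min (D : ℝ) (1 / α ^ 2 * L))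
    have hm2 := le_max_right 1 (min (D : ℝ) (1 / α ^ 2 * L))
    -- For D = 1 the logarithm may vanish, but at most one coordinate is sampled. For D ≥ 2, L ≥ log
    -- 2 > 1/2 lets 1/α² be absorbed into 2L/α².
    rcases hD.eq_or_lt with rfl | hD2
    · push_cast at hdim
      linarith
    · rcases le_total (D : ℝ) (1 / α ^ 2 * L) with h | h
      · rw [min_eq_left h] at hm1 hm2 ⊢
        linarith
      · rw [min_eq_right h] at hm1 hm2 ⊢
        have hL2 : 1 / 2 ≤ L := by
          have h2 : (2 : ℝ) ≤ D := by exact_mod_cast hD2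
          have h3 := Real.log_le_log two_pos (h2.trans hDle)
          have h4 := Real.log_two_gt_d9
          linarith
        have hα2 : 0 < 1 / α ^ 2 := by positivity
        -- Uses (1+α)² ≤ 2(1+α²).
        have h5 : 8 * (1 + α) ^ 2 / α ^ 2 ≤ 16 + 16 * (1 / α ^ 2) := by
          rw [div_le_iff₀ (by positivity), add_mul, mul_assoc 16, one_div,
            inv_mul_cancel₀ (by positivity)]
          nlinarith [sq_nonneg (1 - α)]
        have h6 : 4 * ε₀ ^ 2 / α ^ 2 = 8 * (1 / α ^ 2 * L) := by
          rw [hεsq]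
          ring
        have h7 : 1 / α ^ 2 * (1 / 2) ≤ 1 / α ^ 2 * L := mul_le_mul_of_nonneg_left hL2 hα2.le
        linarith
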